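/- A finite quandle is a finite set $Q$ with a binary operation $*$ such that, for all $a,b,c\in Q$: $a*a=a$; there is a unique $x\in Q$ with $x*b=a$; and $(a*b)*c=(a*c)*(b*c)$. For $i\in Q$ let $\mu_i$ be the permutation $j\mapsto j*i$ of $Q$. The quandle is connected if for all $i,j\in Q$ there are finitely many $k_1,\dots,k_m\in Q$ with $j=(\cdots((i*k_1)*k_2)*\cdots)*k_m$. An isomorphism of quandles is a bijection $\alpha$ with $\alpha(i*j)=\alpha(i)*'\alpha(j)$ for all $i,j$. For integers $n,f$ with $n>f+1>2$, a quandle of cyclic type of order $n$ with $f$ fixed points is a quandle with $n$ elements each of whose permutations $\mu_i$ consists of $f$ fixed points and one cycle of length $n-f$. **Theorem.** Let $n$ and $f$ be positive integers with $n>f+1>2$, and let $Q$ be a quandle of cyclic type of order $n$ with $f$ fixed points. 1. Assume $n>2f$. (a) Then $Q$ is connected. (b) Moreover, there is exactly one such quandle up to isomorphism: $n=6$, $f=2$, and $Q$ is isomorphic to the octahedron quandle $Q_6^2$ on $\{1,\dots,6\}$, whose multiplication table (with $i*j$ in row $i$ and column $j$) is $$\begin{array}{c|cccccc} * & 1&2&3&4&5&6\\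 \hline 1&1&5&1&6&4&2\\ 2&6&2&5&2&1&3\\ 3&3&6&3&5&2&4\\ 4&5&4&6&4&3&1\\ 5&2&3&4&1&5&5\\ 6&4&1&2&3&6&6\end{array}$$ and $Q_6^2$ is indeed a quandle of cyclic type of order $6$ with $2$ fixed points. 2. Assume $n\le 2f$. (a) Then $Q$ is not connected. (b) If $n=2f$, there is exactly one such quandle up to isomorphism: for every $f>1$, the permutations of $\{1,\dots,2f\}$ $$\mu_1=\mu_2=\cdots=\mu_f=(f+1\;\; f+2\;\cdots\; 2f),\qquad \mu_{f+1}=\mu_{f+2}=\cdots=\mu_{2f}=(1\;\; 2\;\cdots\; f)$$ define a quandle of cyclic type of order $2f$ with $f$ fixed points, and every quandle of cyclic type of order $2f$ with $f$ fixed points is isomorphic to it. -/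

import Mathlib

open scoped Quandles

namespace CyclicQuandle

/-- The permutation attached to an element `i` of a quandle, sending `j` to `i ◃ j`. In the
right-handed notation `j * i = i ◃ j` this is `j ↦ j * i`; the axioms of the Mathlib class `Quandle`
are idempotency, right-invertibility and right self-distributivity for `*`. -/
def perm {Q : Type*} [Quandle Q] (i : Q) : Equiv.Perm Q := Rack.act' i

/-- The pattern of a permutation: the multiset of the lengths of all cycles in its decomposition
into disjoint cycles, fixed points being counted as cycles of length one. -/
def pattern {Q : Type*} [Fintype Q] [DecidableEq Q] (σ : Equiv.Perm Q) : Multiset ℕ :=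
  σ.partition.parts

/-- `Q` is a quandle of cyclic type of order `n` with `f` fixed points: `n - 2 ≥ f > 1`, the quandle
has `n` elements, and each of its permutations has pattern `{1, …, 1, n - f}`, with `f` ones. -/
def IsCyclicType (n f : ℕ) (Q : Type*) [Fintype Q] [DecidableEq Q] [Quandle Q] : Prop :=
  1 < f ∧ f + 2 ≤ n ∧ Fintype.card Q = n ∧
    ∀ i : Q, pattern (perm i) = Multiset.replicate f 1 + {n - f}

/-- Connectedness: any `j` is obtained from any `i` as `(⋯((i * k₁) * k₂) * ⋯) * kₘ` for some finite
sequence `k₁, …, kₘ` (where `a * k = k ◃ a`). -/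
def IsConnected (Q : Type*) [Quandle Q] : Prop :=
  ∀ i j : Q, ∃ ks : List Q, ks.foldl (fun a k => k ◃ a) i = j

/-- Two quandles are isomorphic if some bijection between them respects the operations. -/
def Isomorphic (Q Q' : Type*) [Quandle Q] [Quandle Q'] : Prop :=
  ∃ α : Q ≃ Q', ∀ i j : Q, α (i ◃ j) = α i ◃ α j

/-- The quandle given by a family of permutations with `μ i i = i` and
`μ (μ i j) = μ i * μ j * (μ i)⁻¹`; its operation is `i ◃ j = μ i j`. -/
abbrev quandleOfPerms {Q : Type*} (μ : Q → Equiv.Perm Q) (hfix : ∀ i, μ i i = i)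
    (hconj : ∀ i j, μ (μ i j) = μ i * μ j * (μ i)⁻¹) : Quandle Q where
  act i j := μ i j
  invAct i j := (μ i).symm j
  self_distrib := by intro x y z; simp [hconj]
  left_inv i := (μ i).left_inv
  right_inv i := (μ i).right_inv
  fix := by intro i; exact hfix i

/-- The underlying set of the octahedron quandle; the element `k : Fin 6` stands for the label
`k + 1` in `{1, …, 6}`. -/
def Octahedron : Type := Fin 6

instance : Fintype Octahedron := inferInstanceAs (Fintype (Fin 6))

instance : DecidableEq Octahedron := inferInstanceAs (DecidableEq (Fin 6))

/-- The multiplication table of the octahedron quandle: row `j`, column `i` holds `j * i`, all labels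
being lowered by one. -/
def octahedronTable : Fin 6 → Fin 6 → Fin 6 :=
  ![![0, 4, 0, 5, 3, 1],
    ![5, 1, 4, 1, 0, 2],
    ![2, 5, 2, 4, 1, 3],
    ![4, 3, 5, 3, 2, 0],
    ![1, 2, 3, 0, 4, 4],
    ![3, 0, 1, 2, 5, 5]]

/-- The permutations `j ↦ j * i` of the octahedron quandle. Each of them is a cycle of length four,
so that its inverse is its third iterate. -/
def octahedronPerm (i : Fin 6) : Equiv.Perm (Fin 6) where
  toFun j := octahedronTable j i
  invFun j := octahedronTable (octahedronTable (octahedronTable j i) i) i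
  left_inv := by revert i; unfold Function.LeftInverse; decide
  right_inv := by revert i; unfold Function.RightInverse Function.LeftInverse; decide

/-- The octahedron quandle. -/
instance : Quandle Octahedron :=
  quandleOfPerms (Q := Fin 6) octahedronPerm (by decide) (by decide)

/-- The underlying set of the two-block quandle: `Sum.inl k` stands for `k + 1` in `{1, …, f}` and
`Sum.inr k` stands for `f + k + 1` in `{f + 1, …, 2 f}`. -/
def TwoBlock (f : ℕ) : Type := Fin f ⊕ Fin f

instance (f : ℕ) : Fintype (TwoBlock f) := inferInstanceAs (Fintype (Fin f ⊕ Fin f))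

instance (f : ℕ) : DecidableEq (TwoBlock f) := inferInstanceAs (DecidableEq (Fin f ⊕ Fin f))

/-- The permutations of the two-block quandle: an element of the first block acts as the cycle
`(f + 1, f + 2, …, 2 f)`, an element of the second block acts as the cycle `(1, 2, …, f)`. -/
def twoBlockPerm (f : ℕ) : Fin f ⊕ Fin f → Equiv.Perm (Fin f ⊕ Fin f)
  | Sum.inl _ => Equiv.sumCongr (Equiv.refl (Fin f)) (finRotate f)
  | Sum.inr _ => Equiv.sumCongr (finRotate f) (Equiv.refl (Fin f))

/-- The two-block quandle. -/
instance (f : ℕ) : Quandle (TwoBlock f) :=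
  quandleOfPerms (Q := Fin f ⊕ Fin f) (twoBlockPerm f)
    (by rintro (i | i) <;> simp [twoBlockPerm])
    (by
      intro i j
      rw [eq_mul_inv_iff_mul_eq]
      rcases i with i | i <;> rcases j with j | j <;> ext (k | k) <;> simp [twoBlockPerm])

end CyclicQuandle

namespace CyclicQuandle

open Equiv Equiv.Perm

/-! ### Permutations commuting with a cycle. -/

section Cycles

variable {α : Type*} {σ τ : Perm α} {x : α}

/-! Write `μ_i` for `perm i` and `l = n - f` for the cycle length. If `μ_i` fixes `k`, then `μ_i`
and `μ_k` commute, and commuting cycles whose supports meet have equal supports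
(`fixes_iff_of_fixes`). Everything rests on this.

If `n ≤ 2f`, then `2l ≤ n`, and some union of supports is a proper invariant subset. When no two
supports overlap partially, a single support is invariant. Otherwise two partially overlapping
supports leave a common fixed point by counting, and their union is invariant
(`not_isConnected_of_overlap`). If `n = 2f`, counting excludes partial overlap, so supports are
equal or complementary, and the permutation of a point depends only on its half.

If `n > 2f`, any two supports meet. Then "`μ_k` fixes `i`" is an equivalence relation whose classes
(blocks) are the fixed sets. Connectedness is immediate: some `y` moves both given points, and a
power of `μ_y` takes one to the other. Every cycle returns to the block of a point with one common
period `R`. The powers `v_i = μ_i ^ R` preserve all blocks, depend only on the block of `i`, and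
hence commute. Comparing expressions for `v` at `μ_x k` and `μ_x (μ_x k)` gives `R ∣ 2` and then
`μ_x ^ 4 = 1`. Hence `l = 4` and `f = 2`, and the table of the octahedron is forced. -/

theorem _root_.Equiv.Perm.IsCycle.apply_ne_of_commute (hσ : σ.IsCycle) (h : Commute σ τ)
    (hx : σ x ≠ x) (hτ : τ x ≠ x) {y : α} (hy : σ y ≠ y) : τ y ≠ y := by
  obtain ⟨m, rfl⟩ := hσ.exists_zpow_eq hx hy
  rw [← Perm.mul_apply, ← (h.zpow_left m).eq, Perm.mul_apply]
  exact fun e => hτ ((σ ^ m).injective e)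

theorem _root_.Equiv.Perm.IsCycle.zpow_eq_zpow (hσ : σ.IsCycle) (hx : σ x ≠ x) {m k : ℤ}
    (h : (σ ^ m) x = (σ ^ k) x) : σ ^ m = σ ^ k := by
  ext y
  by_cases hy : σ y = y
  · rw [zpow_apply_eq_self_of_apply_eq_self hy, zpow_apply_eq_self_of_apply_eq_self hy]
  · obtain ⟨s, rfl⟩ := hσ.exists_zpow_eq hx hy
    rw [← Perm.mul_apply, ← Perm.mul_apply, ← zpow_add, ← zpow_add, add_comm, zpow_add,
      add_comm, zpow_add, Perm.mul_apply, Perm.mul_apply, h]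

theorem _root_.Equiv.Perm.IsCycle.zpow_eq_one (hσ : σ.IsCycle) (hx : σ x ≠ x) {m : ℤ}
    (h : (σ ^ m) x = x) :
    σ ^ m = 1 := by
  simpa using hσ.zpow_eq_zpow hx (m := m) (k := 0) (by simpa using h)

theorem _root_.Equiv.Perm.IsCycle.exists_eq_zpow_of_commute (hσ : σ.IsCycle) (h : Commute σ τ)
    (hs : ∀ y, σ y = y ↔ τ y = y) : ∃ t : ℤ, τ = σ ^ t := by
  obtain ⟨x, hx, -⟩ := id hσ
  have hx' : σ (τ x) ≠ τ x := fun e => hx (by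
    rw [← Perm.mul_apply, h.eq, Perm.mul_apply] at e
    exact τ.injective e)
  obtain ⟨t, ht⟩ := hσ.exists_zpow_eq hx hx'
  refine ⟨t, ?_⟩
  ext y
  by_cases hy : σ y = y
  · rw [zpow_apply_eq_self_of_apply_eq_self hy, (hs y).1 hy]
  · obtain ⟨s, rfl⟩ := hσ.exists_zpow_eq hx hy
    rw [← Perm.mul_apply, ← (h.zpow_left s).eq, Perm.mul_apply, ← ht, ← Perm.mul_apply,
      ← Perm.mul_apply, ← zpow_add, ← zpow_add, add_comm]

end Cycles

/-! ### Patterns with a single nontrivial cycle. -/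

section Pattern

variable {Q : Type*} [Fintype Q] [DecidableEq Q] {σ : Perm Q} {n f : ℕ}

theorem isCycle_of_pattern (h : f + 2 ≤ n) (hσ : pattern σ = Multiset.replicate f 1 + {n - f}) :
    σ.IsCycle ∧ σ.support.card = n - f := by
  have h1 : σ.cycleType = {n - f} := by
    rw [← filter_parts_partition_eq_cycleType]
    change (pattern σ).filter _ = _
    rw [hσ, Multiset.filter_add, Multiset.filter_singleton, if_pos (by omega),
      Multiset.filter_eq_nil.2, zero_add]
    intro a ha
    rw [Multiset.eq_of_mem_replicate ha]
    norm_num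
  refine ⟨card_cycleType_eq_one.1 (by simp [h1]), ?_⟩
  rw [← sum_cycleType, h1, Multiset.sum_singleton]

theorem pattern_of_isCycle (hσ : σ.IsCycle) (hf : Fintype.card Q - σ.support.card = f)
    (hs : σ.support.card = n - f) : pattern σ = Multiset.replicate f 1 + {n - f} := by
  unfold pattern
  rw [parts_partition, hσ.cycleType, hf, hs, add_comm]

end Pattern

/-! ### Automorphisms and the permutations of a quandle. -/

section Perm

variable {Q : Type*} [Quandle Q]

theorem perm_apply (i j : Q) : perm i j = i ◃ j := rfl

theorem perm_self (i : Q) : perm i i = i := Quandle.fix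

theorem perm_perm_apply (i j : Q) : perm (perm i j) = perm i * perm j * (perm i)⁻¹ :=
  Rack.ad_conj i j

/-- The permutations that are automorphisms of a quandle. -/
def automorphisms (Q : Type*) [Quandle Q] : Subgroup (Perm Q) where
  carrier := {g | ∀ j, perm (g j) = g * perm j * g⁻¹}
  one_mem' j := by simp
  mul_mem' {g h} hg hh j := by
    rw [Perm.mul_apply, hg, hh]
    group
  inv_mem' {g} hg j := by
    have := hg (g⁻¹ j)
    rw [show g (g⁻¹ j) = j from g.apply_symm_apply j] at this
    rw [this]
    group

theorem perm_mem (i : Q) : perm i ∈ automorphisms Q := perm_perm_apply i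

theorem perm_image {g : Perm Q} (hg : g ∈ automorphisms Q) (j : Q) :
    perm (g j) = g * perm j * g⁻¹ := hg j

theorem perm_image_zpow {g : Perm Q} (hg : g ∈ automorphisms Q) (j : Q) (m : ℤ) :
    perm (g j) ^ m = g * perm j ^ m * g⁻¹ := by
  rw [perm_image hg, conj_zpow]

theorem perm_image_apply {g : Perm Q} (hg : g ∈ automorphisms Q) (j k : Q) :
    perm (g j) (g k) = g (perm j k) := by
  simp [perm_image hg]

theorem commute_perm {i k : Q} (h : perm i k = k) : Commute (perm i) (perm k) := by
  have := perm_perm_apply i k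
  rw [h, eq_mul_inv_iff_mul_eq] at this
  exact this.symm

/-- If `μ i` fixes `k`, then the supports of `μ i` and `μ k` agree as soon as they meet. -/
theorem fixes_iff_of_fixes (hc : ∀ i : Q, (perm i).IsCycle) {i k x : Q} (h : perm i k = k)
    (hi : perm i x ≠ x) (hk : perm k x ≠ x) (y : Q) : perm i y = y ↔ perm k y = y := by
  have hik := commute_perm h
  have h1 := fun hy => (hc i).apply_ne_of_commute hik hi hk (y := y) hy
  have h2 := fun hy => (hc k).apply_ne_of_commute hik.symm hk hi (y := y) hy
  tauto

end Perm

/-- The hypothesis `σ ^ f = 1` handles the wrap-around from the last index to `0`. -/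
theorem pow_finRotate {α : Type*} {f : ℕ} {σ : Perm α} (h : σ ^ f = 1) (m : Fin f) :
    σ ^ (finRotate f m : ℕ) = σ * σ ^ (m : ℕ) := by
  rcases f with - | f
  · exact m.elim0
  rw [coe_finRotate]
  split_ifs with hm
  · rw [← pow_succ', hm, Fin.val_last, h, pow_zero]
  · rw [pow_succ']

/-! ### Invariant subsets and isomorphisms. -/

section Invariant

variable {Q : Type*} [Quandle Q]

theorem not_isConnected_of_invariant (S : Set Q) (hS : ∀ c, ∀ a ∈ S, perm c a ∈ S) {a b : Q}
    (ha : a ∈ S) (hb : b ∉ S) : ¬ IsConnected Q := by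
  intro h
  obtain ⟨ks, rfl⟩ := h a b
  apply hb
  clear hb
  induction ks generalizing a with
  | nil => exact ha
  | cons k ks ih => exact ih (hS k a ha)

theorem perm_perm_apply_ne {c a : Q} (h : perm c a ≠ a) : perm c (perm c a) ≠ perm c a :=
  fun e => h ((perm c).injective e)

theorem isomorphic_of_bijective {Q' : Type*} [Quandle Q'] {α : Q' → Q} (hα : Function.Bijective α)
    (h : ∀ i j, α (i ◃ j) = perm (α i) (α j)) : Isomorphic Q Q' := by
  let e := Equiv.ofBijective α hα
  have he : ∀ q, α (e.symm q) = q := e.apply_symm_apply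
  refine ⟨e.symm, fun i j => hα.1 ?_⟩
  rw [he, h, he, he, perm_apply]

end Invariant

/-! ### Many fixed points: disconnectedness and the two-block quandle. -/

section Overlap

variable {Q : Type*} [Quandle Q]

/-- The supports of the permutations of `i` and `k` meet without being equal. -/
def Overlap (i k : Q) : Prop :=
  (∃ x, perm i x ≠ x ∧ perm k x ≠ x) ∧ ¬ ∀ y, perm i y = y ↔ perm k y = y

theorem Overlap.symm {i k : Q} (h : Overlap i k) : Overlap k i := by
  obtain ⟨⟨x, h1, h2⟩, h3⟩ := h
  exact ⟨⟨x, h2, h1⟩, fun h => h3 fun y => (h y).symm⟩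

theorem Overlap.apply_ne (hc : ∀ i : Q, (perm i).IsCycle) {i k : Q} (h : Overlap i k) :
    perm i k ≠ k := by
  obtain ⟨⟨x, h1, h2⟩, h3⟩ := h
  exact fun e => h3 (fixes_iff_of_fixes hc e h1 h2)

theorem Overlap.image {i k : Q} (h : Overlap i k) {g : Perm Q} (hg : g ∈ automorphisms Q) :
    Overlap (g i) (g k) := by
  obtain ⟨⟨x, h1, h2⟩, h3⟩ := h
  refine ⟨⟨g x, ?_, ?_⟩, fun h => h3 fun y => ?_⟩
  · rw [perm_image_apply hg]; exact fun e => h1 (g.injective e)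
  · rw [perm_image_apply hg]; exact fun e => h2 (g.injective e)
  · simpa [perm_image_apply hg] using h (g y)

/-- The points moved by `μ_k` form one cycle, which contains `i`. A power of `μ_k` is an
automorphism that fixes `k` and takes `i` to `y`. -/
theorem Overlap.of_apply_ne (hc : ∀ i : Q, (perm i).IsCycle) {i k y : Q} (h : Overlap i k)
    (hy : perm k y ≠ y) : Overlap y k := by
  obtain ⟨m, rfl⟩ := (hc k).exists_zpow_eq (h.symm.apply_ne hc) hy
  have := h.image ((automorphisms Q).zpow_mem (perm_mem k) m)
  rwa [zpow_apply_eq_self_of_apply_eq_self (perm_self k)] at this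

/-- If `μ_k` moved `z`, then `μ_k` and `μ_y` would have the same support. So `y` would overlap with
`i`, and `μ_i` would move `y`. -/
theorem Overlap.fixes_of_fixes (hc : ∀ i : Q, (perm i).IsCycle) {i k y z : Q} (h : Overlap i k)
    (hi : perm i y = y) (hk : perm k y = y) (hz : perm y z ≠ z) : perm k z = z := by
  by_contra hkz
  have hs := fixes_iff_of_fixes hc hk hkz hz
  obtain ⟨⟨x, h1, h2⟩, h3⟩ := h
  have : Overlap i y :=
    ⟨⟨x, h1, fun e => h2 ((hs x).2 e)⟩, fun h' => h3 fun w => (h' w).trans (hs w).symm⟩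
  exact this.apply_ne hc hi

/-- The union `S` of the two supports is invariant. A point outside `S` fixes `S` pointwise. If `c`
in `S` sent a point of `S` to some `z` outside, then `z`, being moved by `μ_c`, would overlap with
`c` and therefore move it. -/
theorem not_isConnected_of_overlap (hc : ∀ i : Q, (perm i).IsCycle) {i k y : Q}
    (h : Overlap i k) (hi : perm i y = y) (hk : perm k y = y) : ¬ IsConnected Q := by
  have key : ∀ c a, perm i c = c → perm k c = c → (perm i a ≠ a ∨ perm k a ≠ a) →
      perm c a = a := by
    intro c a hic hkc ha
    by_contra hca
    rcases ha with ha | ha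
    · exact ha (h.symm.fixes_of_fixes hc hkc hic hca)
    · exact ha (h.fixes_of_fixes hc hic hkc hca)
  refine not_isConnected_of_invariant {a | perm i a ≠ a ∨ perm k a ≠ a} ?_
    (a := k) (Or.inl (h.apply_ne hc)) (b := y) (by simp [hi, hk])
  intro c a ha
  by_cases hca : perm c a = a
  · rwa [hca]
  have hc' : perm i c ≠ c ∨ perm k c ≠ c := by
    by_contra! hcc
    exact hca (key c a hcc.1 hcc.2 ha)
  by_contra hz
  simp only [Set.mem_ofPred_eq, not_or, not_not] at hz
  have hzc : perm (perm c a) c ≠ c := by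
    have h1 : ∃ e, Overlap e c := by
      rcases hc' with h' | h'
      · exact ⟨i, (h.symm.of_apply_ne hc h').symm⟩
      · exact ⟨k, (h.of_apply_ne hc h').symm⟩
    obtain ⟨e, he⟩ := h1
    exact (he.of_apply_ne hc (perm_perm_apply_ne hca)).apply_ne hc
  exact hzc (key _ c hz.1 hz.2 hc')

theorem not_isConnected_of_not_overlap (hc : ∀ i : Q, (perm i).IsCycle)
    (h : ∀ i k : Q, ¬ Overlap i k) (i : Q) : ¬ IsConnected Q := by
  obtain ⟨x, hx, -⟩ := hc i
  refine not_isConnected_of_invariant {a | perm i a ≠ a} ?_ (a := x) hx (b := i)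
    (by simp [perm_self])
  intro c a ha
  by_cases hca : perm c a = a
  · rwa [hca]
  have : ∀ y, perm i y = y ↔ perm c y = y := by
    by_contra h'
    exact h i c ⟨⟨a, ha, hca⟩, h'⟩
  exact fun e => perm_perm_apply_ne hca ((this _).1 e)

variable [Fintype Q] [DecidableEq Q] {l : ℕ}

theorem Overlap.support_inter_nonempty {i k : Q} (h : Overlap i k) :
    ((perm i).support ∩ (perm k).support).Nonempty := by
  obtain ⟨⟨x, h1, h2⟩, -⟩ := h
  exact ⟨x, by simp [h1, h2]⟩

theorem Overlap.support_ne {i k : Q} (h : Overlap i k) : (perm i).support ≠ (perm k).support := by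
  intro e
  refine h.2 fun y => ?_
  have := Finset.ext_iff.1 e y
  simp only [mem_support] at this
  tauto

theorem Overlap.exists_fixed {i k : Q} (h : Overlap i k) (hs : ∀ i : Q, (perm i).support.card = l)
    (hl : 2 * l ≤ Fintype.card Q) : ∃ y, perm i y = y ∧ perm k y = y := by
  by_contra! hn
  have h1 : (perm i).support ∪ (perm k).support = Finset.univ := by
    ext y
    have := hn y
    simp only [Finset.mem_union, mem_support, Finset.mem_univ, iff_true]
    tauto
  have h2 := Finset.card_union_add_card_inter (perm i).support (perm k).support
  rw [h1, Finset.card_univ, hs, hs] at h2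
  have := h.support_inter_nonempty.card_pos
  omega

theorem not_isConnected_of_card (hc : ∀ i : Q, (perm i).IsCycle)
    (hs : ∀ i : Q, (perm i).support.card = l) (hl : 2 * l ≤ Fintype.card Q) [Nonempty Q] :
    ¬ IsConnected Q := by
  by_cases h : ∃ i k : Q, Overlap i k
  · obtain ⟨i, k, h⟩ := h
    obtain ⟨y, hi, hk⟩ := h.exists_fixed hs hl
    exact not_isConnected_of_overlap hc h hi hk
  · push Not at h
    exact not_isConnected_of_not_overlap hc h (Classical.arbitrary Q)

/-- The union of two overlapping supports has more than `l` points, and the support of a common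
fixed point would be disjoint from it. Together they would have more than `2l` points. -/
theorem not_overlap_of_card (hc : ∀ i : Q, (perm i).IsCycle)
    (hs : ∀ i : Q, (perm i).support.card = l) (hl : 2 * l = Fintype.card Q) (i k : Q) :
    ¬ Overlap i k := by
  intro h
  obtain ⟨y, hi, hk⟩ := h.exists_fixed hs hl.le
  have h1 : Disjoint (perm y).support ((perm i).support ∪ (perm k).support) := by
    rw [Finset.disjoint_left]
    intro z hz
    rw [mem_support] at hz
    simp [h.fixes_of_fixes hc hi hk hz, h.symm.fixes_of_fixes hc hk hi hz]
  have h2 : (perm i).support ⊂ (perm i).support ∪ (perm k).support := by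
    refine Finset.ssubset_iff_subset_ne.2 ⟨Finset.subset_union_left, fun e => h.support_ne ?_⟩
    exact (Finset.eq_of_subset_of_card_le (Finset.union_eq_left.1 e.symm) (by rw [hs, hs])).symm
  have h3 := Finset.card_lt_card h2
  have h4 := Finset.card_le_univ ((perm y).support ∪ ((perm i).support ∪ (perm k).support))
  rw [Finset.card_union_of_disjoint h1] at h4
  rw [hs] at h3 h4
  omega

/-- In a quandle whose permutations move half of the points, the support of the permutation of a
point `k` moved by `d` is complementary to that of `d`. -/
theorem apply_ne_iff_of_apply_ne (hc : ∀ i : Q, (perm i).IsCycle)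
    (hs : ∀ i : Q, (perm i).support.card = l) (hl : 2 * l = Fintype.card Q) {d k : Q}
    (hk : perm d k ≠ k) (y : Q) : perm k y ≠ y ↔ perm d y = y := by
  have h1 : Disjoint (perm k).support (perm d).support := by
    rw [Finset.disjoint_left]
    intro z hz hz'
    rw [mem_support] at hz hz'
    have : ¬ ∀ y, perm k y = y ↔ perm d y = y := fun h => hk ((h k).1 (perm_self k))
    exact not_overlap_of_card hc hs hl k d ⟨⟨z, hz, hz'⟩, this⟩
  have h2 : (perm k).support = (perm d).supportᶜ := by
    refine Finset.eq_of_subset_of_card_le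
      (Finset.subset_compl_iff_disjoint_right.2 h1) ?_
    rw [Finset.card_compl, hs, hs]
    omega
  have := Finset.ext_iff.1 h2 y
  simpa using this

/-- The point `e` is the image of `d` under a power of `μ_c`, and `μ_c` commutes with `μ_d` because
their supports are complementary. -/
theorem perm_eq_of_fixes (hc : ∀ i : Q, (perm i).IsCycle)
    (hs : ∀ i : Q, (perm i).support.card = l) (hl : 2 * l = Fintype.card Q) {d c e : Q}
    (hdc : perm d c ≠ c) (he : perm d e = e) : perm e = perm d := by
  have h := apply_ne_iff_of_apply_ne hc hs hl hdc
  obtain ⟨m, rfl⟩ := (hc c).exists_zpow_eq ((h d).2 (perm_self d)) ((h e).2 he)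
  have hd : Commute (perm c) (perm d) := by
    refine Equiv.Perm.Disjoint.commute fun x => ?_
    have := h x
    tauto
  rw [perm_image ((automorphisms Q).zpow_mem (perm_mem c) m), (hd.zpow_left m).eq,
    mul_inv_cancel_right]

theorem exists_pow_lt_eq (hc : ∀ i : Q, (perm i).IsCycle)
    (hs : ∀ i : Q, (perm i).support.card = l) {i x y : Q} (hx : perm i x ≠ x)
    (hy : perm i y ≠ y) : ∃ m < l, (perm i ^ m) x = y := by
  obtain ⟨m, hm⟩ := (hc i).exists_pow_eq hx hy
  have ho : orderOf (perm i) = l := by rw [(hc i).orderOf, hs]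
  refine ⟨m % l, Nat.mod_lt _ (ho ▸ orderOf_pos _), ?_⟩
  rw [← ho, pow_mod_orderOf, hm]

theorem isomorphic_twoBlock (hc : ∀ i : Q, (perm i).IsCycle)
    (hs : ∀ i : Q, (perm i).support.card = l) (hl : 2 * l = Fintype.card Q) [Nonempty Q] :
    Isomorphic Q (TwoBlock l) := by
  let d : Q := Classical.arbitrary Q
  obtain ⟨c, hdc, -⟩ := id (hc d)
  have h := apply_ne_iff_of_apply_ne hc hs hl hdc
  have hcd : perm c d ≠ d := (h d).2 (perm_self d)
  have h' := apply_ne_iff_of_apply_ne hc hs hl hcd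
  have hone : ∀ i : Q, perm i ^ l = 1 := fun i => by
    rw [← hs i, ← (hc i).orderOf, pow_orderOf_eq_one]
  let α : Fin l ⊕ Fin l → Q := Sum.elim (fun m => (perm c ^ (m : ℕ)) d)
    (fun m => (perm d ^ (m : ℕ)) c)
  have hsurj : Function.Surjective α := by
    intro q
    by_cases hq : perm d q = q
    · obtain ⟨m, hm, e⟩ := exists_pow_lt_eq hc hs hcd ((h q).2 hq)
      exact ⟨Sum.inl ⟨m, hm⟩, e⟩
    · obtain ⟨m, hm, e⟩ := exists_pow_lt_eq hc hs hdc hq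
      exact ⟨Sum.inr ⟨m, hm⟩, e⟩
  have hbij : Function.Bijective α :=
    (Fintype.bijective_iff_surjective_and_card α).2 ⟨hsurj, by simp; omega⟩
  have hl1 : ∀ m : Fin l, perm d (α (Sum.inl m)) = α (Sum.inl m) := by
    intro m
    rw [← h]
    have := pow_apply_mem_support (f := perm c) (n := (m : ℕ)) (x := d)
    simpa [α] using hcd
  have hl2 : ∀ m : Fin l, perm c (α (Sum.inr m)) = α (Sum.inr m) := by
    intro m
    rw [← h']
    simpa [α] using hdc
  have hp1 : ∀ m : Fin l, perm (α (Sum.inl m)) = perm d := fun m =>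
    perm_eq_of_fixes hc hs hl hdc (hl1 m)
  have hp2 : ∀ m : Fin l, perm (α (Sum.inr m)) = perm c := fun m =>
    perm_eq_of_fixes hc hs hl hcd (hl2 m)
  have hom : ∀ i j : Fin l ⊕ Fin l, α (twoBlockPerm l i j) = perm (α i) (α j) := by
    rintro (i | i) (j | j)
    · rw [hp1, hl1]; rfl
    · rw [hp1]
      change (perm d ^ (finRotate l j : ℕ)) c = _
      rw [pow_finRotate (hone d)]; rfl
    · rw [hp2]
      change (perm c ^ (finRotate l j : ℕ)) d = _
      rw [pow_finRotate (hone c)]; rfl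
    · rw [hp2, hl2]; rfl
  exact isomorphic_of_bijective (Q' := TwoBlock l) hbij hom

end Overlap

/-! ### Few fixed points: blocks and their common period. -/

section Blocks

variable {Q : Type*} [Quandle Q]

/-- The permutations of `i` and `k` have the same fixed points. -/
def SameFixed (i k : Q) : Prop := ∀ y, perm i y = y ↔ perm k y = y

theorem SameFixed.symm {i k : Q} (h : SameFixed i k) : SameFixed k i := fun y => (h y).symm

theorem SameFixed.trans {i j k : Q} (h : SameFixed i j) (h' : SameFixed j k) : SameFixed i k :=
  fun y => (h y).trans (h' y)

theorem SameFixed.refl (i : Q) : SameFixed i i := fun _ => Iff.rfl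

theorem sameFixed_image_iff {g : Perm Q} (hg : g ∈ automorphisms Q) {i k : Q} :
    SameFixed (g i) (g k) ↔ SameFixed i k := by
  have key : ∀ {g : Perm Q}, g ∈ automorphisms Q → ∀ {i k : Q},
      SameFixed (g i) (g k) → SameFixed i k := by
    intro g hg i k h y
    simpa [perm_image_apply hg] using h (g y)
  refine ⟨key hg, fun h => key (inv_mem hg) ?_⟩
  simpa using h

/-- Any two permutations have a common moved point. -/
def Meeting (Q : Type*) [Quandle Q] : Prop := ∀ i k : Q, ∃ y, perm i y ≠ y ∧ perm k y ≠ y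

variable (hc : ∀ i : Q, (perm i).IsCycle) (hM : Meeting Q)
include hc hM

theorem sameFixed_iff {i k : Q} : SameFixed i k ↔ perm k i = i := by
  refine ⟨fun h => (h i).1 (perm_self i), fun h => ?_⟩
  obtain ⟨y, hi, hk⟩ := hM i k
  exact SameFixed.symm (fixes_iff_of_fixes hc h hk hi)

theorem apply_ne_symm {i k : Q} (h : perm k i ≠ i) : perm i k ≠ k := fun e =>
  h ((sameFixed_iff hc hM).1 ((sameFixed_iff hc hM).2 e).symm)

theorem exists_zpow_perm_eq (i j : Q) :
    ∃ (y : Q) (m : ℤ), perm y i ≠ i ∧ perm i y ≠ y ∧ (perm y ^ m) i = j := by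
  obtain ⟨y, hi, hj⟩ := hM i j
  obtain ⟨m, hm⟩ := (hc y).exists_zpow_eq (apply_ne_symm hc hM hi) (apply_ne_symm hc hM hj)
  exact ⟨y, m, apply_ne_symm hc hM hi, hi, hm⟩

/-- For fixed `i` and `x`, the exponents returning `x` to its block form a subgroup of `ℤ`; `R`
generates it. It is the same for all pairs because powers of `μ_i` permute the points moved by `i`,
and automorphisms act transitively. -/
theorem exists_period [Nonempty Q] : ∃ R : ℤ, ∀ (i x : Q) (s : ℤ), perm i x ≠ x →
    (SameFixed ((perm i ^ s) x) x ↔ R ∣ s) := by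
  have hz : ∀ (i : Q) (s : ℤ), perm i ^ s ∈ automorphisms Q := fun i s =>
    zpow_mem (perm_mem i) s
  have indep : ∀ (i x x' : Q) (s : ℤ), perm i x ≠ x → perm i x' ≠ x' →
      (SameFixed ((perm i ^ s) x) x ↔ SameFixed ((perm i ^ s) x') x') := by
    intro i x x' s hx hx'
    obtain ⟨m, rfl⟩ := (hc i).exists_zpow_eq hx hx'
    rw [← Perm.mul_apply (perm i ^ s), (Commute.zpow_zpow_self (perm i) s m).eq, Perm.mul_apply,
      sameFixed_image_iff (hz i m)]
  let k : Q := Classical.arbitrary Q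
  obtain ⟨x, hx, -⟩ := id (hc k)
  let H : AddSubgroup ℤ :=
    { carrier := {s | SameFixed ((perm k ^ s) x) x}
      zero_mem' := by
        change SameFixed ((perm k ^ (0 : ℤ)) x) x
        rw [zpow_zero]
        exact SameFixed.refl x
      add_mem' := by
        intro s t hs ht
        change SameFixed ((perm k ^ (s + t)) x) x
        rw [zpow_add, Perm.mul_apply]
        exact ((sameFixed_image_iff (hz k s)).2 ht).trans hs
      neg_mem' := by
        intro s hs
        change SameFixed ((perm k ^ (-s)) x) x
        have := (sameFixed_image_iff (hz k (-s))).2 hs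
        rw [← Perm.mul_apply, ← zpow_add, neg_add_cancel, zpow_zero] at this
        exact this.symm }
  obtain ⟨R, hR⟩ := Int.subgroup_cyclic H
  refine ⟨R, fun i y s hy => ?_⟩
  obtain ⟨z, m, -, -, rfl⟩ := exists_zpow_perm_eq hc hM k i
  have hg := hz z m
  set g := perm z ^ m
  have hgx : perm (g k) (g x) ≠ g x := by
    rw [perm_image_apply hg]
    exact fun e => hx (g.injective e)
  rw [indep _ _ _ s hy hgx, perm_image_zpow hg, Perm.mul_apply, Perm.mul_apply,
    show g⁻¹ (g x) = x from g.symm_apply_apply x, sameFixed_image_iff hg]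
  change s ∈ H ↔ _
  rw [hR, ← AddSubgroup.zmultiples_eq_closure, Int.mem_zmultiples_iff]

variable {R : ℤ} (hR : ∀ (i x : Q) (s : ℤ), perm i x ≠ x →
    (SameFixed ((perm i ^ s) x) x ↔ R ∣ s))
include hR

theorem perm_zpow_eq_of_sameFixed {i j : Q} (h : SameFixed i j) :
    perm i ^ R = perm j ^ R := by
  obtain ⟨y, m, hyi, hiy, rfl⟩ := exists_zpow_perm_eq hc hM i j
  have hg : perm y ^ m ∈ automorphisms Q := zpow_mem (perm_mem y) m
  obtain ⟨t, ht⟩ := (hc i).exists_eq_zpow_of_commute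
    (commute_perm ((sameFixed_iff hc hM).1 h.symm)) h
  have h1 := perm_image_zpow hg i R
  rw [ht, ← zpow_mul] at h1
  rw [ht, ← zpow_mul]
  -- Both sides are powers of the cycle `μ_i`, so agreement at the moved point `y` suffices. There,
  -- `g` is a power of `μ_y`, and it fixes `y` and also `μ_i ^ R y`, which lies in the block of `y`.
  refine (hc i).zpow_eq_zpow hiy ?_
  have h2 : perm y ((perm i ^ R) y) = (perm i ^ R) y :=
    (sameFixed_iff hc hM).1 ((hR i y R hiy).2 dvd_rfl)
  rw [h1, Perm.mul_apply, Perm.mul_apply, ← zpow_neg,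
    zpow_apply_eq_self_of_apply_eq_self (perm_self y), zpow_apply_eq_self_of_apply_eq_self h2]

omit hc hM in
theorem sameFixed_zpow_period (i j : Q) : SameFixed ((perm i ^ R) j) j := by
  by_cases h : perm i j = j
  · rw [zpow_apply_eq_self_of_apply_eq_self h]
    exact SameFixed.refl j
  · exact (hR i j R h).2 dvd_rfl

/-- `v_i` carries `j` to a point of the same block, which has the same `v`; so conjugation by `v_i`
fixes `v_j`. -/
theorem commute_zpow_period (i j : Q) : Commute (perm i ^ R) (perm j ^ R) := by
  have h := perm_zpow_eq_of_sameFixed hc hM hR (sameFixed_zpow_period hR i j)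
  rw [perm_image_zpow (zpow_mem (perm_mem i) R), mul_inv_eq_iff_eq_mul] at h
  exact h

/-- Since `v_x` preserves the block of `k`, it conjugates `μ_k` to some `μ_k ^ t`. Since it also
preserves the block of `μ_k x`, `R` divides `t - 1`. -/
theorem exists_perm_zpow_period_eq {k x : Q} (hx : perm k x ≠ x) :
    ∃ w : ℤ, perm (perm k x) ^ R = (perm k ^ R) ^ w * perm x ^ R := by
  have hs := sameFixed_zpow_period hR x k
  obtain ⟨t, ht⟩ := (hc k).exists_eq_zpow_of_commute
    (commute_perm ((sameFixed_iff hc hM).1 hs)) hs.symm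
  have h1 : (perm x ^ R) (perm k x) = (perm k ^ t) x := by
    rw [← ht, perm_image (zpow_mem (perm_mem x) R), Perm.mul_apply, Perm.mul_apply, ← zpow_neg,
      zpow_apply_eq_self_of_apply_eq_self (perm_self x)]
  have h2 := sameFixed_zpow_period hR x (perm k x)
  rw [h1, show (perm k ^ t) x = (perm k ^ (t - 1)) (perm k x) by
    rw [← Perm.mul_apply, ← zpow_add_one, sub_add_cancel],
    hR k _ _ (perm_perm_apply_ne hx)] at h2
  obtain ⟨w, hw⟩ := h2
  refine ⟨-w, ?_⟩
  rw [perm_image (zpow_mem (perm_mem x) R), mul_inv_eq_iff_eq_mul,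
    show t = 1 + R * w by omega, zpow_add, zpow_one, zpow_mul] at ht
  have hcom := (commute_zpow_period hc hM hR k x).zpow_left w
  have hcom' : Commute (perm k) ((perm k ^ R) ^ w) :=
    ((Commute.refl (perm k)).zpow_right R).zpow_right w
  rw [perm_image_zpow (perm_mem k), mul_inv_eq_iff_eq_mul, zpow_neg, mul_assoc,
    eq_inv_mul_iff_mul_eq, ht, ← mul_assoc, hcom'.eq]

omit hc hM hR in
theorem perm_pow_apply_zpow_period_eq {k x : Q} {w : ℤ}
    (hw : perm (perm k x) ^ R = (perm k ^ R) ^ w * perm x ^ R) (m : ℕ) :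
    perm ((perm k ^ m) x) ^ R = (perm k ^ R) ^ (w * m) * perm x ^ R := by
  rw [perm_image_zpow (perm_mem k)] at hw
  induction m with
  | zero => simp
  | succ m ih =>
    have hcom : Commute (perm k) ((perm k ^ R) ^ (w * m)) :=
      ((Commute.refl (perm k)).zpow_right R).zpow_right _
    rw [pow_succ', Perm.mul_apply, perm_image_zpow (perm_mem k), ih, ← mul_assoc, hcom.eq,
      mul_assoc, mul_assoc, ← mul_assoc (perm k), hw, ← mul_assoc, ← zpow_add]
    push_cast
    ring_nf

variable [Finite Q]

/-- As `R ∤ 1`, `μ_x k` also lies on the cycle of `k` through `x`. This yields two expressions, `v_x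
^ w' * v_k` and `v_k ^ (w * m) * v_x`. Their comparison makes `v_x ^ (w' - 1)` a power of `v_k`, so
it fixes `k` and is trivial. -/
theorem perm_apply_zpow_period_eq (hR1 : ¬ R ∣ 1) {k x : Q} (hx : perm k x ≠ x) :
    perm (perm x k) ^ R = perm x ^ R * perm k ^ R := by
  have hk : perm x k ≠ k := apply_ne_symm hc hM hx
  obtain ⟨w, hw⟩ := exists_perm_zpow_period_eq hc hM hR hx
  obtain ⟨w', hw'⟩ := exists_perm_zpow_period_eq hc hM hR hk
  have h1 : perm k (perm x k) ≠ perm x k := by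
    rw [Ne, ← sameFixed_iff hc hM]
    have := hR x k 1 hk
    rw [zpow_one] at this
    rwa [this]
  obtain ⟨m, hm⟩ := (hc k).exists_pow_eq hx h1
  have h2 := perm_pow_apply_zpow_period_eq hw m
  rw [hm, hw'] at h2
  have hcom := (commute_zpow_period hc hM hR k x).zpow_left (w * m)
  have h3 : (perm x ^ R) ^ (w' - 1) = (perm k ^ R) ^ (w * m - 1) := by
    rw [hcom.eq] at h2
    rw [zpow_sub_one, zpow_sub_one, eq_mul_inv_iff_mul_eq, mul_assoc,
      ((commute_zpow_period hc hM hR x k).inv_left).eq, ← mul_assoc, h2,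
      (commute_zpow_period hc hM hR x k |>.zpow_right (w * m)).eq, mul_inv_cancel_right]
  have h4 : (perm x ^ R) ^ (w' - 1) = 1 := by
    rw [← zpow_mul]
    refine (hc x).zpow_eq_one hk ?_
    rw [zpow_mul, h3, ← zpow_mul]
    exact zpow_apply_eq_self_of_apply_eq_self (perm_self k) _
  rw [hw', show w' = w' - 1 + 1 by ring, zpow_add_one, h4, one_mul]

theorem perm_apply_apply_zpow_period_eq (hR1 : ¬ R ∣ 1) {k x : Q} (hx : perm k x ≠ x) :
    perm (perm x (perm x k)) ^ R = perm x ^ R * (perm x ^ R * perm k ^ R) := by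
  have h := perm_apply_zpow_period_eq hc hM hR hR1 hx
  have hcom : Commute (perm x) (perm x ^ R) := (Commute.refl (perm x)).zpow_right R
  rw [perm_image_zpow (perm_mem x), h, ← mul_assoc, hcom.eq, mul_assoc, mul_assoc,
    ← mul_assoc (perm x), ← perm_image_zpow (perm_mem x), h]

variable (hv : ∀ i : Q, perm i ^ R ≠ 1)
include hv

omit hM hR [Finite Q] in
theorem apply_zpow_period_ne {i x : Q} (hx : perm i x ≠ x) : (perm i ^ R) x ≠ x := fun e =>
  hv i ((hc i).zpow_eq_one hx e)

/-- Otherwise `μ_x (μ_x k)` lies on the cycle of `k`, so `v_x ^ 2 * v_k` equals a power of `v_k`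
times `v_x`. Cancelling `v_x` and evaluating at `k` shows that `v_x` fixes `k`, which is impossible.
-/
theorem period_dvd_two [Nonempty Q] (hR1 : ¬ R ∣ 1) : R ∣ 2 := by
  obtain ⟨k⟩ := ‹Nonempty Q›
  obtain ⟨x, hx, -⟩ := id (hc k)
  have hk : perm x k ≠ k := apply_ne_symm hc hM hx
  by_contra h2
  have h1 : perm k (perm x (perm x k)) ≠ perm x (perm x k) := by
    rw [Ne, ← sameFixed_iff hc hM]
    have := hR x k 2 hk
    rw [zpow_two, Perm.mul_apply] at this
    rwa [this]
  obtain ⟨m, hm⟩ := (hc k).exists_pow_eq hx h1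
  obtain ⟨w, hw⟩ := exists_perm_zpow_period_eq hc hM hR hx
  have h3 := perm_pow_apply_zpow_period_eq hw m
  rw [hm, perm_apply_apply_zpow_period_eq hc hM hR hR1 hx,
    ((commute_zpow_period hc hM hR k x).zpow_left (w * m)).eq] at h3
  have h4 := congrArg (fun σ : Perm Q => σ k) (mul_left_cancel h3)
  simp only [Perm.mul_apply, ← zpow_mul] at h4
  rw [zpow_apply_eq_self_of_apply_eq_self (perm_self k),
    zpow_apply_eq_self_of_apply_eq_self (perm_self k)] at h4
  exact apply_zpow_period_ne hc hv hk h4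

/-- As `R ∣ 2`, the points `k` and `μ_x (μ_x k)` share a block, so `v_k = v_x ^ 2 * v_k`. -/
theorem perm_pow_four [Nonempty Q] (hR1 : ¬ R ∣ 1) (x : Q) : perm x ^ 4 = 1 := by
  obtain ⟨k, hk, -⟩ := id (hc x)
  have hx := apply_ne_symm hc hM hk
  obtain ⟨c, hc2⟩ := period_dvd_two hc hM hR hv hR1
  have h1 : SameFixed (perm x (perm x k)) k := by
    have := (hR x k 2 hk).2 ⟨c, hc2⟩
    rwa [zpow_two, Perm.mul_apply] at this
  have h2 := perm_zpow_eq_of_sameFixed hc hM hR h1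
  rw [perm_apply_apply_zpow_period_eq hc hM hR hR1 hx, ← mul_assoc, mul_eq_right,
    ← zpow_add] at h2
  have h3 : perm x ^ (4 : ℤ) = 1 := by
    rw [show (4 : ℤ) = (R + R) * c by linarith, zpow_mul, h2, one_zpow]
  exact_mod_cast h3

end Blocks

/-! ### Reduction to four-cycles and the octahedron quandle. -/

section FourCycles

variable {Q : Type*} [Quandle Q] [Fintype Q] [DecidableEq Q] {l f : ℕ}

theorem meeting_of_card (hs : ∀ i : Q, (perm i).support.card = l) (hl : Fintype.card Q < 2 * l) :
    Meeting Q := by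
  intro i k
  by_contra! h
  have hd : Disjoint (perm i).support (perm k).support := by
    rw [Finset.disjoint_left]
    intro y hy
    rw [mem_support] at hy
    simpa using h y hy
  have := Finset.card_le_univ ((perm i).support ∪ (perm k).support)
  rw [Finset.card_union_of_disjoint hd, hs, hs] at this
  omega

omit [DecidableEq Q] in
theorem isConnected_of_meeting (hc : ∀ i : Q, (perm i).IsCycle) (hM : Meeting Q) :
    IsConnected Q := by
  intro i j
  obtain ⟨y, hi, hj⟩ := hM i j
  obtain ⟨m, rfl⟩ := (hc y).exists_pow_eq (apply_ne_symm hc hM hi) (apply_ne_symm hc hM hj)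
  refine ⟨List.replicate m y, ?_⟩
  clear hi hj
  induction m generalizing i with
  | zero => rfl
  | succ m ih => rw [pow_succ, Perm.mul_apply, ← ih]; rfl

/-- Every permutation is a cycle of length four, and the two fixed points of the permutation of `x`
are opposite points of the cycle of any `k` moving `x`. -/
structure IsFourCyclic (Q : Type*) [Quandle Q] : Prop where
  pow_four : ∀ i : Q, perm i ^ 4 = 1
  apply_apply_ne : ∀ k x : Q, perm k x ≠ x → perm k (perm k x) ≠ x
  fixes_apply_apply : ∀ k x : Q, perm k x ≠ x → perm x (perm k (perm k x)) = perm k (perm k x)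
  eq_or_eq : ∀ k x y : Q, perm k x ≠ x → perm x y = y → y = x ∨ y = perm k (perm k x)

theorem isFourCyclic_of_meeting (hc : ∀ i : Q, (perm i).IsCycle) (hM : Meeting Q)
    (hs : ∀ i : Q, (perm i).support.card = l) (hn : Fintype.card Q = f + l) (hf : 2 ≤ f)
    (hfl : f < l) : IsFourCyclic Q ∧ l = 4 ∧ f = 2 := by
  have : Nonempty Q := Fintype.card_pos_iff.1 (by omega)
  obtain ⟨R, hR⟩ := exists_period hc hM
  have hfix : ∀ x : Q, (perm x).supportᶜ.card = f := by
    intro x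
    rw [Finset.card_compl, hs]
    omega
  have exists_eq : ∀ k x y : Q, perm k x ≠ x → perm x y = y →
      ∃ c : ℤ, (perm k ^ (R * c)) x = y := by
    intro k x y hx hy
    have hyx : SameFixed y x := (sameFixed_iff hc hM).2 hy
    have hy' : perm k y ≠ y :=
      apply_ne_symm hc hM fun e => apply_ne_symm hc hM hx ((hyx k).1 e)
    obtain ⟨s, rfl⟩ := (hc k).exists_zpow_eq hx hy'
    obtain ⟨c, rfl⟩ := (hR k x s hx).1 hyx
    exact ⟨c, rfl⟩
  -- Otherwise the whole cycle of `k` lies in one block, giving `l ≤ f`.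
  have hR1 : ¬ R ∣ 1 := by
    intro h
    obtain ⟨k⟩ := ‹Nonempty Q›
    obtain ⟨x, hx, -⟩ := id (hc k)
    have hsub : (perm k).support ⊆ (perm x).supportᶜ := by
      intro y hy
      rw [mem_support] at hy
      obtain ⟨s, rfl⟩ := (hc k).exists_zpow_eq hx hy
      have := (sameFixed_iff hc hM).1 ((hR k x s hx).2 (h.trans (one_dvd s)))
      simpa using this
    have := Finset.card_le_card hsub
    rw [hs, hfix] at this
    omega
  -- A block has at least two points because `f ≥ 2`, and a multiple of `R` steps along a cycle
  -- joins them.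
  have hv : ∀ i : Q, perm i ^ R ≠ 1 := by
    intro k h
    obtain ⟨x, hx, -⟩ := id (hc k)
    obtain ⟨y, hy, hne⟩ := Finset.exists_mem_ne (by rw [hfix]; omega) x (s := (perm x).supportᶜ)
    obtain ⟨c, rfl⟩ := exists_eq k x y hx (by simpa using hy)
    apply hne
    rw [zpow_mul, h, one_zpow, Perm.one_apply]
  have hR2 := period_dvd_two hc hM hR hv hR1
  have h4 := perm_pow_four hc hM hR hv hR1
  have h2R : 2 ∣ R := by
    obtain ⟨c, hc2⟩ := id hR2
    rcases Int.prime_two.dvd_mul.1 (hc2 ▸ dvd_rfl : (2 : ℤ) ∣ R * c) with h | ⟨d, rfl⟩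
    · exact h
    · exact absurd ⟨d, by linarith⟩ hR1
  have eq_or_eq : ∀ k x y : Q, perm k x ≠ x → perm x y = y →
      y = x ∨ y = perm k (perm k x) := by
    intro k x y hx hy
    obtain ⟨c, rfl⟩ := exists_eq k x y hx hy
    obtain ⟨d, rfl⟩ := h2R
    have h4' : perm k ^ (4 : ℤ) = 1 := by exact_mod_cast h4 k
    rcases Int.even_or_odd' (d * c) with ⟨e, he | he⟩
    · left
      rw [mul_assoc, he, ← mul_assoc, zpow_mul, show (2 : ℤ) * 2 = 4 by norm_num, h4', one_zpow,
        Perm.one_apply]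
    · right
      rw [mul_assoc, he, show 2 * (2 * e + 1) = 4 * e + 2 by ring, zpow_add, zpow_mul, h4',
        one_zpow, one_mul, zpow_two, Perm.mul_apply]
  -- The length `l` divides `4` and exceeds `f ≥ 2`.
  have hl : l = 4 := by
    obtain ⟨k⟩ := ‹Nonempty Q›
    have h := orderOf_dvd_of_pow_eq_one (h4 k)
    rw [(hc k).orderOf, hs] at h
    have := Nat.le_of_dvd (by norm_num) h
    interval_cases l
    all_goals omega
  refine ⟨⟨h4, ?_, ?_, eq_or_eq⟩, hl, ?_⟩
  · intro k x hx e
    have h1 := (hc k).zpow_eq_one hx (m := 2) (by rwa [zpow_two, Perm.mul_apply])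
    have h := orderOf_dvd_of_pow_eq_one (by exact_mod_cast h1 : perm k ^ 2 = 1)
    rw [(hc k).orderOf, hs, hl] at h
    omega
  · intro k x hx
    have := (hR k x 2 hx).2 hR2
    rw [zpow_two, Perm.mul_apply] at this
    exact (sameFixed_iff hc hM).1 this
  · obtain ⟨k⟩ := ‹Nonempty Q›
    obtain ⟨x, hx, -⟩ := id (hc k)
    have hsub : (perm x).supportᶜ ⊆ {x, perm k (perm k x)} := by
      intro y hy
      have := eq_or_eq k x y hx (by simpa using hy)
      simpa using this
    have h1 := (Finset.card_le_card hsub).trans Finset.card_le_two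
    rw [hfix] at h1
    omega

theorem octahedronTable_self_distrib (i j k : Fin 6) :
    octahedronTable (octahedronTable k i) (octahedronTable j i) =
      octahedronTable (octahedronTable k j) i := by
  revert i j k
  decide

theorem exists_octahedronTable_eq (i j : Fin 6) : ∃ k, octahedronTable k i = j := by
  revert i j
  decide

omit [Fintype Q] [DecidableEq Q] in
/-- The octahedron quandle is generated by two of its elements. -/
theorem hom_of_generators {α : Fin 6 → Q}
    (h0 : ∀ j, α (octahedronTable j 0) = perm (α 0) (α j))
    (h1 : ∀ j, α (octahedronTable j 1) = perm (α 1) (α j)) (i j : Fin 6) :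
    α (octahedronTable j i) = perm (α i) (α j) := by
  have step : ∀ i i', (∀ j, α (octahedronTable j i) = perm (α i) (α j)) →
      (∀ j, α (octahedronTable j i') = perm (α i') (α j)) →
      ∀ j, α (octahedronTable j (octahedronTable i' i)) =
        perm (α (octahedronTable i' i)) (α j) := by
    intro i i' h h' j
    obtain ⟨k, rfl⟩ := exists_octahedronTable_eq i j
    -- The elements at which `α` intertwines the actions are closed under the operation; writing `j`
    -- as an image under the action of `i` makes self-distributivity applicable.
    rw [octahedronTable_self_distrib, h, h', h, h, perm_image_apply (perm_mem _)]
  have h5 := step 0 1 h0 h1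
  have h3 := step 0 5 h0 h5
  have h4 := step 0 3 h0 h3
  have h2 := step 1 4 h1 h4
  fin_cases i
  exacts [h0 j, h1 j, h2 j, h3 j, h4 j, h5 j]

theorem isomorphic_octahedron (hc : ∀ i : Q, (perm i).IsCycle) (hM : Meeting Q)
    (hs : ∀ i : Q, (perm i).support.card = 4) (hn : Fintype.card Q = 6) (h : IsFourCyclic Q) :
    Isomorphic Q Octahedron := by
  have : Nonempty Q := Fintype.card_pos_iff.1 (by omega)
  obtain ⟨k⟩ := this
  obtain ⟨x, hx, -⟩ := id (hc k)
  have hk : perm x k ≠ k := apply_ne_symm hc hM hx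
  have h4 : ∀ i y : Q, perm i (perm i (perm i (perm i y))) = y := fun i y =>
    congrArg (fun σ : Perm Q => σ y) (h.pow_four i)
  have hbx := perm_perm_apply_ne hx
  have hxbx : perm x (perm k x) ≠ perm k x := by
    intro e
    rcases h.eq_or_eq k x _ hx e with e | e
    · exact hx e
    · exact hbx e.symm
  -- The opposite of `μ_k x` is the same on the cycles of `x` and of `k`: it is the second fixed
  -- point of the permutation of `μ_k x`.
  have hopp : perm x (perm x (perm k x)) = perm k (perm k (perm k x)) := by
    rcases h.eq_or_eq k (perm k x) _ hbx (h.fixes_apply_apply x (perm k x) hxbx) with e | e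
    · exact absurd e (h.apply_apply_ne _ _ hxbx)
    · exact e
  have hak : perm k (perm x k) ≠ perm x k := by
    intro e
    rcases h.eq_or_eq x k _ hk e with e | e
    · exact hk e
    · exact perm_perm_apply_ne hk e.symm
  -- Of the four points on the cycle of `k`, the first three are excluded in turn; the case `μ_k x`
  -- would force `μ_x (μ_x k) = k`.
  have hxk : perm x k = perm k (perm k (perm k x)) := by
    obtain ⟨m, hm, e⟩ := exists_pow_lt_eq hc hs hx hak
    interval_cases m
    · have e : x = perm x k := e
      have := perm_perm_apply_ne hk
      rw [← e] at this
      exact absurd (perm_self x) this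
    · have e : perm k x = perm x k := e
      have h1 : perm x (perm k (perm k (perm k x))) = k := by
        rw [← hopp, e, h4]
      have h2 := perm_image_apply (perm_mem k) x (perm k (perm k (perm k x)))
      have h3 := perm_image_apply (perm_mem x) k x
      rw [h4, h1, perm_self] at h2
      rw [perm_self, ← e, h2, e] at h3
      exact absurd h3.symm (h.apply_apply_ne x k hk)
    · have e : perm k (perm k x) = perm x k := e
      have := perm_perm_apply_ne hk
      rw [← e] at this
      exact absurd (h.fixes_apply_apply k x hx) this
    · exact e.symm
  have hxk3 : perm x (perm x (perm x k)) = perm k x := by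
    rw [hxk, ← hopp, h4]
  -- The points `k` and `x` play the generators `0` and `1`; the pairs of opposite points are `{0,
  -- 2}`, `{1, 3}` and `{4, 5}`.
  let α : Fin 6 → Q := ![k, x, perm x (perm x k), perm k (perm k x), perm k (perm k (perm k x)),
    perm k x]
  have hsurj : Function.Surjective α := by
    intro q
    by_cases hq : perm k q = q
    · rcases h.eq_or_eq x k q hk hq with rfl | rfl
      · exact ⟨0, rfl⟩
      · exact ⟨2, rfl⟩
    · obtain ⟨m, hm, rfl⟩ := exists_pow_lt_eq hc hs hx hq
      interval_cases m
      exacts [⟨1, rfl⟩, ⟨5, rfl⟩, ⟨3, rfl⟩, ⟨4, rfl⟩]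
  have hbij : Function.Bijective α :=
    (Fintype.bijective_iff_surjective_and_card α).2 ⟨hsurj, by simp [hn]⟩
  have h0 : ∀ j, α (octahedronTable j 0) = perm (α 0) (α j) := by
    intro j
    fin_cases j
    exacts [(perm_self k).symm, rfl, (h.fixes_apply_apply x k hk).symm, rfl, (h4 k x).symm, rfl]
  have h1 : ∀ j, α (octahedronTable j 1) = perm (α 1) (α j) := by
    intro j
    fin_cases j
    exacts [hxk.symm, (perm_self x).symm, hxk3.symm, (h.fixes_apply_apply k x hx).symm,
      congrArg (perm x) hxk, (h4 x k).symm.trans (congrArg (perm x) hxk3)]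
  exact isomorphic_of_bijective (Q' := Octahedron) hbij (hom_of_generators h0 h1)

end FourCycles

/-! ### The two model quandles are of cyclic type. -/

section Examples

theorem isCycle_octahedronPerm (i : Fin 6) : (octahedronPerm i).IsCycle := by
  have h : ∀ i, ∃ x, octahedronPerm i x ≠ x ∧ ∀ y, octahedronPerm i y ≠ y →
      ∃ m : Fin 4, (octahedronPerm i ^ (m : ℕ)) x = y := by decide
  obtain ⟨x, hx, hy⟩ := h i
  exact ⟨x, hx, fun y h => let ⟨m, hm⟩ := hy y h; ⟨(m : ℕ), by simpa using hm⟩⟩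

theorem card_support_octahedronPerm (i : Fin 6) : (octahedronPerm i).support.card = 4 := by
  revert i
  decide

theorem isCyclicType_octahedron : IsCyclicType 6 2 Octahedron :=
  ⟨by norm_num, by norm_num, rfl, fun (i : Fin 6) => pattern_of_isCycle (σ := octahedronPerm i)
    (isCycle_octahedronPerm i) (by rw [card_support_octahedronPerm]; rfl)
    (card_support_octahedronPerm i)⟩

variable {α β : Type*} {σ : Perm α} {τ : Perm β} {e : α ↪ β}

theorem isCycle_of_semiconj (h : ∀ a, τ (e a) = e (σ a)) (h' : ∀ b, b ∉ Set.range e → τ b = b)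
    (hσ : σ.IsCycle) : τ.IsCycle := by
  obtain ⟨x, hx, hσ⟩ := hσ
  refine ⟨e x, by rw [h]; exact fun hx' => hx (e.injective hx'), fun y hy => ?_⟩
  obtain ⟨a, rfl⟩ : y ∈ Set.range e := by
    by_contra hy'
    exact hy (h' y hy')
  obtain ⟨m, rfl⟩ := hσ fun ha => hy (by rw [h, ha])
  refine ⟨m, ?_⟩
  have hnat : ∀ (m : ℕ) (a : α), (τ ^ m) (e a) = e ((σ ^ m) a) := by
    intro m a
    induction m with
    | zero => rfl
    | succ m ih => rw [pow_succ', pow_succ', Perm.mul_apply, ih, h, Perm.mul_apply]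
  rcases m with m | m
  · exact hnat m x
  · rw [zpow_negSucc, zpow_negSucc, Perm.inv_eq_iff_eq, hnat]
    congr 1
    exact ((σ ^ (m + 1)).apply_symm_apply x).symm

theorem card_support_of_semiconj [Fintype α] [Fintype β] [DecidableEq α] [DecidableEq β]
    (h : ∀ a, τ (e a) = e (σ a)) (h' : ∀ b, b ∉ Set.range e → τ b = b) :
    τ.support.card = σ.support.card := by
  rw [← Finset.card_map e]
  congr 1
  ext b
  by_cases hb : b ∈ Set.range e
  · obtain ⟨a, rfl⟩ := hb
    simp [h]
  · have hb' : ∀ a, e a ≠ b := fun a ha => hb ⟨a, ha⟩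
    simp [h' b hb, hb']

theorem twoBlockPerm_spec {f : ℕ} (hf : 1 < f) (i : Fin f ⊕ Fin f) :
    (twoBlockPerm f i).IsCycle ∧ (twoBlockPerm f i).support.card = f := by
  have key : ∀ e : Fin f ↪ Fin f ⊕ Fin f, (∀ a, twoBlockPerm f i (e a) = e (finRotate f a)) →
      (∀ b, b ∉ Set.range e → twoBlockPerm f i b = b) →
      (twoBlockPerm f i).IsCycle ∧ (twoBlockPerm f i).support.card = f := by
    intro e h h'
    refine ⟨isCycle_of_semiconj h h' (isCycle_finRotate_of_le hf), ?_⟩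
    rw [card_support_of_semiconj h h', support_finRotate_of_le hf, Finset.card_univ,
      Fintype.card_fin]
  rcases i with i | i
  · exact key Function.Embedding.inr (fun a => rfl)
      (by rintro (b | b) hb <;> simp_all [twoBlockPerm])
  · exact key Function.Embedding.inl (fun a => rfl)
      (by rintro (b | b) hb <;> simp_all [twoBlockPerm])

theorem isCyclicType_twoBlock {f : ℕ} (hf : 1 < f) : IsCyclicType (2 * f) f (TwoBlock f) := by
  have hcard : Fintype.card (Fin f ⊕ Fin f) = 2 * f := by simp; omega
  refine ⟨hf, by omega, hcard, fun i => ?_⟩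
  obtain ⟨h1, h2⟩ := twoBlockPerm_spec hf i
  exact pattern_of_isCycle (σ := twoBlockPerm f i) h1 (by rw [h2, hcard]; omega) (by rw [h2]; omega)

end Examples

end CyclicQuandle

theorem theorem1p1 :
    -- every quandle of cyclic type with several fixed points is as described
    (∀ (n f : ℕ), n > f + 1 → f + 1 > 2 →
      ∀ (Q : Type*) [Fintype Q] [DecidableEq Q] [Quandle Q],
        CyclicQuandle.IsCyclicType n f Q →
        (n > 2 * f →
          CyclicQuandle.IsConnected Q ∧
          n = 6 ∧ f = 2 ∧ CyclicQuandle.Isomorphic Q CyclicQuandle.Octahedron) ∧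
        (n ≤ 2 * f →
          ¬ CyclicQuandle.IsConnected Q ∧
          (n = 2 * f → CyclicQuandle.Isomorphic Q (CyclicQuandle.TwoBlock f)))) ∧
    -- the quandles of the classification do occur
    CyclicQuandle.IsCyclicType 6 2 CyclicQuandle.Octahedron ∧
    (∀ f : ℕ, f > 1 →
      CyclicQuandle.IsCyclicType (2 * f) f (CyclicQuandle.TwoBlock f)) := by
  refine ⟨?_, CyclicQuandle.isCyclicType_octahedron,
    fun f hf => CyclicQuandle.isCyclicType_twoBlock hf⟩
  rintro n f hnf hf Q _ _ _ ⟨-, hfn, rfl, hp⟩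
  have hc := fun i => (CyclicQuandle.isCycle_of_pattern hfn (hp i)).1
  have hs := fun i => (CyclicQuandle.isCycle_of_pattern hfn (hp i)).2
  have hQ : Nonempty Q := Fintype.card_pos_iff.1 (by omega)
  constructor
  · intro h
    have hM := CyclicQuandle.meeting_of_card hs (by omega)
    obtain ⟨h4, hl, rfl⟩ :=
      CyclicQuandle.isFourCyclic_of_meeting (f := f) hc hM hs (by omega) (by omega) (by omega)
    rw [hl] at hs
    exact ⟨CyclicQuandle.isConnected_of_meeting hc hM, by omega, rfl,
      CyclicQuandle.isomorphic_octahedron hc hM hs (by omega) h4⟩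
  · intro h
    refine ⟨CyclicQuandle.not_isConnected_of_card hc hs (by omega), fun hn => ?_⟩
    rw [show Fintype.card Q - f = f by omega] at hs
    exact CyclicQuandle.isomorphic_twoBlock hc hs hn.symm
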